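/- Let $M,C,K\in\mathbb{C}^{n\times n}$ be such that the quadratic matrix polynomial $Q(\lambda)=\lambda^2M+\lambda C+K$ is regular, i.e. $\det Q(\lambda)\not\equiv 0$, and let $$C_2(\lambda)=A-\lambda B,\qquad A=\begin{pmatrix} C & -I_n\\ K & 0\end{pmatrix},\quad B=\begin{pmatrix}-M & 0\\ 0 & -I_n\end{pmatrix}$$ be its second companion linearization. Apply Van Dooren's staircase algorithm for the eigenvalue zero to $A-\lambda B$. That is, set $A_{1,1}=A$, $B_{1,1}=B$, $n_1=2n$, and as long as $A_{j,j}$ is singular, perform the following step. Put $s_j=n_j-\operatorname{rank}A_{j,j}$ and $n_{j+1}=n_j-s_j$. Compute a singular value decomposition $A_{j,j}=U_A\Sigma_AV_A^*$, and let $B_j$ consist of the last $s_j$ columns of $B_{j,j}V_A$. Compute a singular value decomposition $B_j=U_B\Sigma_BV_B^*$, and let the $n_{j+1}\times n_{j+1}$ pencil $A_{j+1,j+1}-\lambda B_{j+1,j+1}$ be the block of $U_B^*(A_{j,j}-\lambda B_{j,j})V_A$ in the last $n_{j+1}$ rows and the first $n_{j+1}$ columns. The algorithm ends, after $\ell\ge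 0$ steps, when $A_{\ell+1,\ell+1}$ is nonsingular, and its output is the list of indices $s_1,\dots,s_\ell$; put $s_j=0$ for $j>\ell$. Then the algorithm can be carried out to its end, and the indices obtained in any run (whatever singular value decompositions are chosen) determine completely the structure of the eigenvalue zero of the quadratic eigenvalue problem $Q(\lambda)x=0$: for every $j\ge 1$, $Q(\lambda)$ has exactly $s_j-s_{j+1}$ elementary divisors $\lambda^j$ (that is, exactly $s_j-s_{j+1}$ Jordan blocks of size $j$ for the eigenvalue zero). Here the number of elementary divisors $\lambda^j$ is the number of invariant polynomials of $Q$ (the diagonal entries of the Smith form of $Q$, which exists) that are divisible by $\lambda^j$ but not by $\lambda^{j+1}$. -/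

import Mathlib

open Matrix Polynomial

noncomputable section

namespace QuadEig

/-! ### The quadratic matrix polynomial and its second companion pencil -/

/-- The quadratic matrix polynomial `Q(λ) = λ² M + λ C + K`, as a matrix over `ℂ[λ]`. -/
def quadPoly {n : ℕ} (M C K : Matrix (Fin n) (Fin n) ℂ) : Matrix (Fin n) (Fin n) ℂ[X] :=
  (X ^ 2 : ℂ[X]) • M.map Polynomial.C + (X : ℂ[X]) • C.map Polynomial.C + K.map Polynomial.C

/-- The constant coefficient `A = [C, -I; K, 0]` of the second companion form
`C₂(λ) = A - λ B`. -/
def companionA {n : ℕ} (C K : Matrix (Fin n) (Fin n) ℂ) :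
    Matrix (Fin (n + n)) (Fin (n + n)) ℂ :=
  Matrix.reindex finSumFinEquiv finSumFinEquiv (Matrix.fromBlocks C (-1) K 0)

/-- The coefficient `B = [-M, 0; 0, -I]` of the second companion form `C₂(λ) = A - λ B`. -/
def companionB {n : ℕ} (M : Matrix (Fin n) (Fin n) ℂ) :
    Matrix (Fin (n + n)) (Fin (n + n)) ℂ :=
  Matrix.reindex finSumFinEquiv finSumFinEquiv (Matrix.fromBlocks (-M) 0 0 (-1))

/-! ### Elementary divisors, through the Smith form -/

/-- `d` is the list of invariant polynomials of the square matrix polynomial `P`: the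
`d i` are monic (or zero), each divides the next ones, and `P` is equivalent to `diag(d)`
through unimodular matrix polynomials. -/
structure IsSmithForm {n : ℕ} (P : Matrix (Fin n) (Fin n) ℂ[X]) (d : Fin n → ℂ[X]) :
    Prop where
  monic : ∀ i, d i ≠ 0 → (d i).Monic
  dvd : ∀ i j, i ≤ j → d i ∣ d j
  equiv : ∃ E F : Matrix (Fin n) (Fin n) ℂ[X],
    IsUnit E.det ∧ IsUnit F.det ∧ E * P * F = Matrix.diagonal d

/-- The number of elementary divisors `λ ^ j` (for `j ≥ 1`) of a regular matrix polynomial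
with invariant polynomials `d`: the number of those `d i` in which the prime `λ` occurs to
the power `j` exactly. -/
def zeroDivisorCount {n : ℕ} (d : Fin n → ℂ[X]) (j : ℕ) : ℕ :=
  (Finset.univ.filter fun i => (d i).rootMultiplicity 0 = j).card

/-! ### Van Dooren's staircase algorithm for the eigenvalue zero -/

/-- `Y = U Σ V*` is a singular value decomposition of the `m × k` matrix `Y`, where `Σ` is the
`m × k` diagonal matrix with the diagonal entries `σ 0 ≥ σ 1 ≥ ⋯ ≥ 0`. -/
structure IsSVD {m k : ℕ} (Y : Matrix (Fin m) (Fin k) ℂ) (U : Matrix (Fin m) (Fin m) ℂ)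
    (σ : ℕ → ℝ) (V : Matrix (Fin k) (Fin k) ℂ) : Prop where
  unitary_left : U ∈ Matrix.unitaryGroup (Fin m) ℂ
  unitary_right : V ∈ Matrix.unitaryGroup (Fin k) ℂ
  nonneg : ∀ i, 0 ≤ σ i
  antitone : Antitone σ
  eq : Y = U * (Matrix.of fun (i : Fin m) (j : Fin k) =>
    if (i : ℕ) = (j : ℕ) then (σ i : ℂ) else 0) * Vᴴ

/-- The position of `i` among the first `r` of `m = r + s` indices. -/
def firstIdx {m r s : ℕ} (h : r + s = m) (i : Fin r) : Fin m :=
  ⟨i, by have := i.isLt; omega⟩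

/-- The position of `i` among the last `s` of `m = r + s` indices. -/
def lastIdx {m r s : ℕ} (h : r + s = m) (i : Fin s) : Fin m :=
  ⟨r + i, by have := i.isLt; omega⟩

/-- One step of the algorithm on the `m × m` pencil `A - λ B`, with `r = rank A` and
`s = m - r`. From an SVD `A = U_A Σ V_A*` one gets `A V_A = (A₂ | 0)` and
`B V_A = (B₂ | B₁)`, where `B₁` has `s` columns; from an SVD of `B₁`, with left factor `U_B`,
one gets
`U_B* (A - λ B) V_A = [A₂₁ - λ B₂₁, -λ B₁₁; A₂₂ - λ B₂₂, 0]`, with `s` rows above and `r` rows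
below. The step passes on the `r × r` pencil `A₂₂ - λ B₂₂ = A' - λ B'`. -/
def DeflationStep {m r s : ℕ} (h : r + s = m) (A B : Matrix (Fin m) (Fin m) ℂ)
    (A' B' : Matrix (Fin r) (Fin r) ℂ) : Prop :=
  A.rank = r ∧
  ∃ (UA VA : Matrix (Fin m) (Fin m) ℂ) (σ : ℕ → ℝ)
    (UB : Matrix (Fin m) (Fin m) ℂ) (VB : Matrix (Fin s) (Fin s) ℂ) (τ : ℕ → ℝ),
    IsSVD A UA σ VA ∧
    IsSVD ((B * VA).submatrix id (lastIdx h)) UB τ VB ∧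
    A' = (UBᴴ * A * VA).submatrix (lastIdx ((Nat.add_comm s r).trans h)) (firstIdx h) ∧
    B' = (UBᴴ * B * VA).submatrix (lastIdx ((Nat.add_comm s r).trans h)) (firstIdx h)

/-- `StaircaseRun A B l`: some complete run of the algorithm on the pencil `A - λ B` (for some
choice of the singular value decompositions) outputs the list of indices
`l = [s₁, …, s_ℓ]`. The algorithm performs deflation steps as long as the current constant
coefficient is singular, and stops when it is nonsingular. -/
inductive StaircaseRun : {m : ℕ} → Matrix (Fin m) (Fin m) ℂ → Matrix (Fin m) (Fin m) ℂ →
    List ℕ → Prop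
  | done {m : ℕ} (A B : Matrix (Fin m) (Fin m) ℂ) (hA : IsUnit A.det) : StaircaseRun A B []
  | step {m r s : ℕ} (h : r + s = m) (hs : 0 < s) (A B : Matrix (Fin m) (Fin m) ℂ)
      (A' B' : Matrix (Fin r) (Fin r) ℂ) (l : List ℕ) (hstep : DeflationStep h A B A' B')
      (hrun : StaircaseRun A' B' l) : StaircaseRun A B (s :: l)

/-- The index `s_j`, `j ≥ 1`, in the output `[s₁, …, s_ℓ]`, with `s_j = 0` for `j > ℓ`. -/
def stairIndex (l : List ℕ) (j : ℕ) : ℕ := l.getD (j - 1) 0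

end QuadEig

end

/-! Let N be the cokernel of Q over ℂ[λ]; it is finite-dimensional because Q is regular. By the
Smith form, N is the sum of the ℂ[λ]/(d_i), so with μ_i the order of d_i at 0, dim λ^j N = ∑ deg d_i
- ∑ min(j, μ_i). The second difference of this sequence counts the i with μ_i = j
(`IsSmithForm.colength_add_sum`, `zeroDivisorCount_succ`).

The staircase indices are its first differences, s_j = dim λ^(j-1) N - dim λ^j N. The companion
pencil has a cokernel isomorphic to N (`exists_companion_map`). For a pencil A - λB of size m with
cokernel N', dim N'/λN' = m - rank A (`colength_pencil_one`), and one deflation step produces a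
pencil with cokernel isomorphic to λN' (`DeflationStep.cokernel`). Once A is nonsingular, λ acts
bijectively and the dimensions stay constant. Nothing here depends on the chosen decompositions.

Concretely, λ^j N is handled as the quotient of the free module by `colon P j`, the kernel of v ↦
[λ^j v]. -/

noncomputable section

namespace QuadEig

/-! ### Singular value decompositions and complete runs -/

/-- Every complex matrix has a singular value decomposition. -/
theorem exists_isSVD {m k : ℕ} (Y : Matrix (Fin m) (Fin k) ℂ) :
    ∃ U σ V, IsSVD Y U σ V := by
  let T : EuclideanSpace ℂ (Fin k) →ₗ[ℂ] EuclideanSpace ℂ (Fin m) := Matrix.toLpLin 2 2 Y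
  have hT := T.isSymmetric_adjoint_comp_self
  have hk : Module.finrank ℂ (EuclideanSpace ℂ (Fin k)) = k := finrank_euclideanSpace_fin
  let b : OrthonormalBasis (Fin k) ℂ (EuclideanSpace ℂ (Fin k)) := hT.eigenvectorBasis hk
  have hb : ∀ i, T.adjoint (T (b i)) = ((T.singularValues i ^ 2 : ℝ) : ℂ) • b i := by
    intro i
    have := hT.apply_eigenvectorBasis hk i
    rw [T.sq_singularValues_fin hk]
    exact this
  have hTT : ∀ i j, inner ℂ (T (b i)) (T (b j)) =
      if i = j then ((T.singularValues i ^ 2 : ℝ) : ℂ) else 0 := by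
    intro i j
    rw [← LinearMap.adjoint_inner_right, hb, inner_smul_right, orthonormal_iff_ite.mp b.orthonormal]
    split_ifs with h <;> simp [h]
  set ρ := Module.finrank ℂ (LinearMap.range T) with hρ
  have hρk : ρ ≤ k := hk ▸ LinearMap.finrank_range_le T
  have hρm : ρ ≤ m := by
    have := Submodule.finrank_le (LinearMap.range T)
    rwa [finrank_euclideanSpace_fin] at this
  have hpos : ∀ i : ℕ, i < ρ → 0 < T.singularValues i := fun i hi =>
    T.singularValues_pos_iff_lt_finrank_range.mpr hi
  have hzero : ∀ i : ℕ, ρ ≤ i → T.singularValues i = 0 := fun i hi =>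
    T.singularValues_eq_zero_iff_le_finrank_range.mpr hi
  -- The left singular vectors σ_i⁻¹ T b_i. They are orthonormal for i < ρ, the only range used; the
  -- rest of the basis comes from an arbitrary orthonormal extension.
  let w : Fin m → EuclideanSpace ℂ (Fin m) := fun i =>
    if hi : (i : ℕ) < k then ((T.singularValues i : ℂ))⁻¹ • T (b ⟨i, hi⟩) else 0
  have hw : Orthonormal ℂ (({i : Fin m | (i : ℕ) < ρ} : Set (Fin m)).domRestrict w) := by
    rw [orthonormal_iff_ite]
    rintro ⟨i, hi⟩ ⟨j, hj⟩
    have hi' : (i : ℕ) < ρ := hi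
    have hj' : (j : ℕ) < ρ := hj
    have h0 := (hpos _ hi').ne'
    simp only [Set.domRestrict_apply, w, dif_pos (hi'.trans_le hρk), dif_pos (hj'.trans_le hρk),
      inner_smul_left, inner_smul_right, hTT]
    by_cases hij : i = j
    · subst hij
      have h1 : (T.singularValues i : ℂ) ≠ 0 := by exact_mod_cast h0
      simp
      field_simp
    · have : ¬ (i : ℕ) = j := fun h => hij (Fin.ext h)
      simp [hij, this]
  obtain ⟨u, hu⟩ := hw.exists_orthonormalBasis_extension_of_card_eq (by simp)
  have hTb : ∀ j : Fin k, T (b j) = if hj : (j : ℕ) < m then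
      (T.singularValues j : ℂ) • u ⟨j, hj⟩ else 0 := by
    intro j
    by_cases hj : (j : ℕ) < ρ
    · rw [dif_pos (hj.trans_le hρm), hu ⟨j, hj.trans_le hρm⟩ hj]
      have h0 : (T.singularValues j : ℂ) ≠ 0 := by exact_mod_cast (hpos _ hj).ne'
      simp [w, smul_smul, h0]
    · have h0 : T (b j) = 0 := by
        rw [← inner_self_eq_zero (𝕜 := ℂ), hTT, hzero _ (not_lt.mp hj)]
        simp
      rw [h0, hzero _ (not_lt.mp hj)]
      simp
  let U : Matrix (Fin m) (Fin m) ℂ := (EuclideanSpace.basisFun (Fin m) ℂ).toBasis.toMatrix u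
  let V : Matrix (Fin k) (Fin k) ℂ := (EuclideanSpace.basisFun (Fin k) ℂ).toBasis.toMatrix b
  have hU : U ∈ Matrix.unitaryGroup (Fin m) ℂ :=
    (EuclideanSpace.basisFun (Fin m) ℂ).toMatrix_orthonormalBasis_mem_unitary u
  have hV : V ∈ Matrix.unitaryGroup (Fin k) ℂ :=
    (EuclideanSpace.basisFun (Fin k) ℂ).toMatrix_orthonormalBasis_mem_unitary b
  refine ⟨U, T.singularValues, V, hU, hV, T.singularValues_nonneg, T.singularValues_antitone, ?_⟩
  have key : Y * V = U * (Matrix.of fun (i : Fin m) (j : Fin k) =>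
    if (i : ℕ) = (j : ℕ) then (T.singularValues i : ℂ) else 0) := by
    ext i j
    have h1 : (Y * V) i j = (T (b j)) i := rfl
    rw [h1, hTb j, Matrix.mul_apply]
    split_ifs with hj
    · rw [Finset.sum_eq_single ⟨j, hj⟩]
      · simp [U, Module.Basis.toMatrix_apply, mul_comm]
      · intro c _ hc
        have : ¬ (c : ℕ) = j := fun h => hc (Fin.ext h)
        simp [this]
      · simp
    · symm
      apply Finset.sum_eq_zero
      intro c _
      have : ¬ (c : ℕ) = j := fun h => hj (h ▸ c.isLt)
      simp [this]
  rw [← key, Matrix.mul_assoc]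
  have : V * Vᴴ = 1 := Matrix.mem_unitaryGroup_iff.mp hV
  rw [this, Matrix.mul_one]

/-- A singular A has rank below m, so each step strictly shrinks the pencil. -/
theorem exists_staircaseRun {m : ℕ} (A B : Matrix (Fin m) (Fin m) ℂ) :
    ∃ l, StaircaseRun A B l := by
  induction m using Nat.strong_induction_on with
  | _ m ih =>
    by_cases hA : IsUnit A.det
    · exact ⟨[], .done A B hA⟩
    · have hr : A.rank < m := by
        refine lt_of_le_of_ne (by simpa using A.rank_le_width) fun h => hA ?_
        rw [← Matrix.isUnit_iff_isUnit_det]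
        rw [← Matrix.mulVec_surjective_iff_isUnit]
        exact LinearMap.range_eq_top.mp
          (Submodule.eq_top_of_finrank_eq (S := LinearMap.range A.mulVecLin) (h.trans (by simp)))
      have h : A.rank + (m - A.rank) = m := by omega
      obtain ⟨UA, σ, VA, hA'⟩ := exists_isSVD A
      obtain ⟨UB, τ, VB, hB'⟩ := exists_isSVD ((B * VA).submatrix id (lastIdx h))
      obtain ⟨l, hl⟩ := ih A.rank hr
        ((UBᴴ * A * VA).submatrix (lastIdx ((Nat.add_comm _ _).trans h)) (firstIdx h))
        ((UBᴴ * B * VA).submatrix (lastIdx ((Nat.add_comm _ _).trans h)) (firstIdx h))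
      exact ⟨_, .step h (by omega) A B _ _ l
        ⟨rfl, UA, VA, σ, UB, VB, τ, hA', hB', rfl, rfl⟩ hl⟩

/-! ### Smith form over ℂ[λ] -/

/-- Two square polynomial matrices are equivalent if unimodular factors carry one to the other. -/
def Equivalent {n : ℕ} (P P' : Matrix (Fin n) (Fin n) ℂ[X]) : Prop :=
  ∃ E F : Matrix (Fin n) (Fin n) ℂ[X], IsUnit E.det ∧ IsUnit F.det ∧ E * P * F = P'

theorem Equivalent.refl {n : ℕ} (P : Matrix (Fin n) (Fin n) ℂ[X]) : Equivalent P P :=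
  ⟨1, 1, by simp, by simp, by simp⟩

theorem Equivalent.trans {n : ℕ} {P P' P'' : Matrix (Fin n) (Fin n) ℂ[X]}
    (h : Equivalent P P') (h' : Equivalent P' P'') : Equivalent P P'' := by
  obtain ⟨E, F, hE, hF, rfl⟩ := h
  obtain ⟨E', F', hE', hF', rfl⟩ := h'
  exact ⟨E' * E, F * F', by simpa using ⟨hE', hE⟩, by simpa using ⟨hF, hF'⟩,
    by simp only [Matrix.mul_assoc]⟩

theorem Equivalent.mul_left {n : ℕ} (E P : Matrix (Fin n) (Fin n) ℂ[X]) (hE : IsUnit E.det) :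
    Equivalent P (E * P) := ⟨E, 1, hE, by simp, by simp⟩

theorem Equivalent.mul_right {n : ℕ} (P F : Matrix (Fin n) (Fin n) ℂ[X]) (hF : IsUnit F.det) :
    Equivalent P (P * F) := ⟨1, F, by simp, hF, by simp⟩

theorem Equivalent.transpose {n : ℕ} {P P' : Matrix (Fin n) (Fin n) ℂ[X]}
    (h : Equivalent P P') : Equivalent Pᵀ P'ᵀ := by
  obtain ⟨E, F, hE, hF, rfl⟩ := h
  exact ⟨Fᵀ, Eᵀ, by simpa using hF, by simpa using hE, by simp [Matrix.mul_assoc]⟩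

theorem Equivalent.permute {n : ℕ} (P : Matrix (Fin n) (Fin n) ℂ[X])
    (σ τ : Equiv.Perm (Fin n)) : Equivalent P (P.submatrix σ τ) := by
  have hu : ∀ ρ : Equiv.Perm (Fin n), IsUnit (ρ.permMatrix ℂ[X]).det := by
    intro ρ
    rw [Matrix.det_permutation]
    exact (Units.isUnit _).map (Int.castRingHom ℂ[X])
  refine ⟨σ.permMatrix _, (τ⁻¹).permMatrix _, hu _, hu _, ?_⟩
  refine Matrix.ext fun i j => ?_
  simp [← Equiv.Perm.inv_def, Equiv.Perm.permMatrix, PEquiv.toMatrix_toPEquiv_mul,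
    PEquiv.mul_toMatrix_toPEquiv]

/-- Adding a multiple of the row `j` to the row `i`. -/
theorem Equivalent.add_row {n : ℕ} (P : Matrix (Fin n) (Fin n) ℂ[X]) {i j : Fin n} (hij : i ≠ j)
    (q : ℂ[X]) : Equivalent P (P.updateRow i (P i + q • P j)) := by
  have := Equivalent.mul_left (Matrix.transvection i j q) P
    (by simp [Matrix.det_transvection_of_ne i j hij])
  convert this using 1
  ext a b
  by_cases ha : a = i
  · subst ha; simp
  · simp [ha]

/-- An equivalent matrix with nonzero `(0, 0)` entry of smallest possible degree. -/
theorem exists_equivalent_min {n : ℕ} (P : Matrix (Fin (n + 1)) (Fin (n + 1)) ℂ[X]) (hP : P ≠ 0) :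
    ∃ P', Equivalent P P' ∧ P' 0 0 ≠ 0 ∧
      ∀ P'' i j, Equivalent P P'' → P'' i j ≠ 0 → (P' 0 0).natDegree ≤ (P'' i j).natDegree := by
  have hmove : ∀ (P'' : Matrix (Fin (n + 1)) (Fin (n + 1)) ℂ[X]) i j, Equivalent P P'' →
      ∃ P', Equivalent P P' ∧ P' 0 0 = P'' i j := fun P'' i j h =>
    ⟨_, h.trans (Equivalent.permute P'' (Equiv.swap 0 i) (Equiv.swap 0 j)), by simp⟩
  -- Permutations move any entry to the corner, so minimizing over corner entries minimizes over all
  -- entries of all equivalent matrices.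
  let S : Set ℕ := {k | ∃ P', Equivalent P P' ∧ P' 0 0 ≠ 0 ∧ (P' 0 0).natDegree = k}
  have hS : S.Nonempty := by
    obtain ⟨i, j, hij⟩ : ∃ i j, P i j ≠ 0 := by
      by_contra! h
      exact hP (Matrix.ext h)
    obtain ⟨P', h, h0⟩ := hmove P i j (Equivalent.refl P)
    exact ⟨_, P', h, h0 ▸ hij, rfl⟩
  obtain ⟨P', h, h0, hd⟩ := Nat.sInf_mem hS
  refine ⟨P', h, h0, fun P'' i j h2 h3 => ?_⟩
  obtain ⟨P3, h4, h5⟩ := hmove P'' i j h2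
  rw [hd, ← h5]
  exact Nat.sInf_le ⟨P3, h4, h5 ▸ h3, rfl⟩

/-- In a matrix whose `(0, 0)` entry is minimal in its equivalence class, this entry divides the
entries of the first column. -/
theorem dvd_col_of_min {n : ℕ} (P : Matrix (Fin (n + 1)) (Fin (n + 1)) ℂ[X]) (h0 : P 0 0 ≠ 0)
    (hmin : ∀ P' i j, Equivalent P P' → P' i j ≠ 0 →
      (P 0 0).natDegree ≤ (P' i j).natDegree) (i : Fin (n + 1)) : P 0 0 ∣ P i 0 := by
  by_cases hi : i = 0
  · rw [hi]
  by_contra hdvd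
  -- Subtracting the quotient multiple of row 0 leaves the remainder, whose degree would be too
  -- small.
  have h1 := hmin _ i 0 (Equivalent.add_row P hi (-(P i 0 / P 0 0)))
  have h2 : (P.updateRow i (P i + (-(P i 0 / P 0 0)) • P 0)) i 0 = P i 0 % P 0 0 := by
    simp only [Matrix.updateRow_self, Pi.add_apply, Pi.smul_apply, smul_eq_mul]
    have := EuclideanDomain.div_add_mod (P i 0) (P 0 0)
    linear_combination -this
  rw [h2] at h1
  have h3 : P i 0 % P 0 0 ≠ 0 := fun h => hdvd (EuclideanDomain.mod_eq_zero.mp h)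
  have h4 := Polynomial.natDegree_lt_natDegree h3 (EuclideanDomain.mod_lt (P i 0) h0)
  exact absurd (h1 h3) (not_le.mpr h4)

theorem dvd_row_of_min {n : ℕ} (P : Matrix (Fin (n + 1)) (Fin (n + 1)) ℂ[X]) (h0 : P 0 0 ≠ 0)
    (hmin : ∀ P' i j, Equivalent P P' → P' i j ≠ 0 →
      (P 0 0).natDegree ≤ (P' i j).natDegree) (j : Fin (n + 1)) : P 0 0 ∣ P 0 j :=
  dvd_col_of_min Pᵀ h0 (fun P' i k h hne => hmin P'ᵀ k i (by simpa using h.transpose) hne) j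

/-- Clearing the first column below the `(0, 0)` entry, when this entry divides the column. -/
theorem exists_clear_col {n : ℕ} (P : Matrix (Fin (n + 1)) (Fin (n + 1)) ℂ[X])
    (hdvd : ∀ i, P 0 0 ∣ P i 0) :
    ∃ P', Equivalent P P' ∧ (∀ j, P' 0 j = P 0 j) ∧ ∀ i, i ≠ 0 → P' i 0 = 0 := by
  choose q hq using hdvd
  let E : Matrix (Fin (n + 1)) (Fin (n + 1)) ℂ[X] :=
    Matrix.of fun i j => if i = j then 1 else if j = 0 then - q i else 0
  have hE : E.det = 1 := by
    rw [Matrix.det_of_isLowerTriangular]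
    · simp [E]
    · intro i j hij
      have hij' : i < j := hij
      have : j ≠ 0 := (Fin.zero_le i).trans_lt hij' |>.ne'
      simp [E, hij'.ne, this]
  have hmul : ∀ i j, (E * P) i j = P i j - (if i = 0 then 0 else q i * P 0 j) := by
    intro i j
    rw [Matrix.mul_apply]
    by_cases hi : i = 0
    · subst hi
      simp only [E, Matrix.of_apply, if_true, sub_zero]
      rw [Finset.sum_eq_single 0]
      · simp
      · intro b _ hb
        simp [hb, hb.symm]
      · simp
    · rw [← Finset.add_sum_erase _ _ (Finset.mem_univ i),
        Finset.sum_eq_single (0 : Fin (n + 1))]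
      · simp [E, hi]; ring
      · intro b hb hb0
        simp [E, hb0, (Finset.ne_of_mem_erase hb).symm]
      · intro h
        simp [Ne.symm hi] at h
  refine ⟨E * P, Equivalent.mul_left E P (by simp [hE]), fun j => by simp [hmul], fun i hi => ?_⟩
  rw [hmul, if_neg hi, hq i]
  ring

/-- The matrix `diag(a, P)`. -/
def bordered {n : ℕ} (a : ℂ[X]) (P : Matrix (Fin n) (Fin n) ℂ[X]) :
    Matrix (Fin (n + 1)) (Fin (n + 1)) ℂ[X] :=
  Matrix.of (Fin.cons (Fin.cons a 0) fun i => Fin.cons 0 (P i))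

@[simp] theorem bordered_zero_zero {n : ℕ} (a : ℂ[X]) (P : Matrix (Fin n) (Fin n) ℂ[X]) :
    bordered a P 0 0 = a := rfl

@[simp] theorem bordered_zero_succ {n : ℕ} (a : ℂ[X]) (P : Matrix (Fin n) (Fin n) ℂ[X])
    (j : Fin n) : bordered a P 0 j.succ = 0 := rfl

@[simp] theorem bordered_succ_zero {n : ℕ} (a : ℂ[X]) (P : Matrix (Fin n) (Fin n) ℂ[X])
    (i : Fin n) : bordered a P i.succ 0 = 0 := rfl

@[simp] theorem bordered_succ_succ {n : ℕ} (a : ℂ[X]) (P : Matrix (Fin n) (Fin n) ℂ[X])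
    (i j : Fin n) : bordered a P i.succ j.succ = P i j := rfl

theorem bordered_mul {n : ℕ} (a b : ℂ[X]) (P Q : Matrix (Fin n) (Fin n) ℂ[X]) :
    bordered a P * bordered b Q = bordered (a * b) (P * Q) := by
  ext i j
  rw [Matrix.mul_apply, Fin.sum_univ_succ]
  refine Fin.cases ?_ (fun i => ?_) i <;> refine Fin.cases ?_ (fun j => ?_) j <;>
    simp [Matrix.mul_apply]

theorem det_bordered {n : ℕ} (a : ℂ[X]) (P : Matrix (Fin n) (Fin n) ℂ[X]) :
    (bordered a P).det = a * P.det := by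
  rw [Matrix.det_succ_row_zero, Fin.sum_univ_succ]
  have : (bordered a P).submatrix Fin.succ Fin.succ = P := by
    ext i j; simp
  simp [this]

/-- A nonzero polynomial matrix splits off its first invariant polynomial. -/
theorem exists_equivalent_bordered {n : ℕ} (P : Matrix (Fin (n + 1)) (Fin (n + 1)) ℂ[X])
    (hP : P ≠ 0) :
    ∃ (a : ℂ[X]) (N : Matrix (Fin n) (Fin n) ℂ[X]), a.Monic ∧ Equivalent P (bordered a N) ∧
      ∀ i j, a ∣ N i j := by
  obtain ⟨P₁, h₁, h0, hmin⟩ := exists_equivalent_min P hP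
  -- Minimality belongs to the equivalence class, so every equivalent matrix with the same corner
  -- inherits it.
  have hmin' : ∀ P', Equivalent P P' → P' 0 0 = P₁ 0 0 → ∀ P'' i j, Equivalent P' P'' →
      P'' i j ≠ 0 → (P' 0 0).natDegree ≤ (P'' i j).natDegree := fun P' h h' P'' i j h2 hne =>
    h' ▸ hmin P'' i j (h.trans h2) hne
  have hcol : ∀ P', Equivalent P P' → P' 0 0 = P₁ 0 0 → ∀ i, P₁ 0 0 ∣ P' i 0 := fun P' h h' i =>
    h' ▸ dvd_col_of_min P' (h' ▸ h0) (hmin' P' h h') i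
  have hrow : ∀ P', Equivalent P P' → P' 0 0 = P₁ 0 0 → ∀ j, P₁ 0 0 ∣ P' 0 j := fun P' h h' j =>
    h' ▸ dvd_row_of_min P' (h' ▸ h0) (hmin' P' h h') j
  obtain ⟨P₂, h₂, hr₂, hc₂⟩ := exists_clear_col P₁ (hcol P₁ h₁ rfl)
  have h₂' := h₁.trans h₂
  -- Row 0 is cleared by transposing. Clearing a column keeps row 0, so the zeros already obtained
  -- in column 0 survive.
  obtain ⟨P₃, h₃, hr₃, hc₃⟩ := exists_clear_col P₂ᵀ fun j => by
    have := hrow P₂ h₂' (hr₂ 0) j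
    rwa [← hr₂ 0] at this
  have h₃' : Equivalent P P₃ᵀ := h₂'.trans (by simpa using h₃.transpose)
  set a := P₁ 0 0 with ha
  let N : Matrix (Fin n) (Fin n) ℂ[X] := P₃ᵀ.submatrix Fin.succ Fin.succ
  have hN : P₃ᵀ = bordered a N := by
    refine Matrix.ext fun i j => ?_
    refine Fin.cases ?_ (fun i => ?_) i <;> refine Fin.cases ?_ (fun j => ?_) j
    · simp [hr₃, hr₂, ha]
    · simpa using hc₃ _ (Fin.succ_ne_zero j)
    · simp [hr₃, hc₂]
    · rfl
  rw [hN] at h₃'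
  have hdvd : ∀ i j, a ∣ N i j := by
    intro i j
    -- Adding a lower row to row 0 keeps the corner and brings the entries of N into row 0, where
    -- the corner divides them.
    have h4 := h₃'.trans (Equivalent.add_row (bordered a N) (Fin.succ_ne_zero i).symm 1)
    simpa using hrow _ h4 (by simp) j.succ
  have hlc : a.leadingCoeff⁻¹ ≠ 0 := inv_ne_zero (Polynomial.leadingCoeff_ne_zero.mpr h0)
  refine ⟨C a.leadingCoeff⁻¹ * a, N, ?_, h₃'.trans ?_, fun i j => ?_⟩
  · rw [mul_comm]; exact Polynomial.monic_mul_leadingCoeff_inv h0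
  · have := Equivalent.mul_left (bordered (C a.leadingCoeff⁻¹) 1) (bordered a N)
      (by simpa [det_bordered] using h0)
    simpa [bordered_mul] using this
  · rw [(Polynomial.isUnit_C.mpr hlc.isUnit).mul_left_dvd]
    exact hdvd i j

/-- Every square polynomial matrix has a Smith form. -/
theorem exists_isSmithForm {n : ℕ} (P : Matrix (Fin n) (Fin n) ℂ[X]) :
    ∃ d, IsSmithForm P d := by
  induction n with
  | zero => exact ⟨0, fun i => i.elim0, fun i => i.elim0, 1, 1, by simp, by simp,
      Matrix.ext fun i => i.elim0⟩
  | succ n ih =>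
    by_cases hP : P = 0
    · subst hP
      exact ⟨0, fun i h => absurd rfl h, fun i j _ => dvd_rfl, 1, 1, by simp, by simp, by simp⟩
    obtain ⟨a, N, ha, h, hdvd⟩ := exists_equivalent_bordered P hP
    obtain ⟨d, hmonic, hd, E, F, hE, hF, hEF⟩ := ih N
    have had : ∀ i, a ∣ d i := by
      intro i
      have : d i = (E * N * F) i i := by simp [hEF]
      rw [this, Matrix.mul_apply]
      refine Finset.dvd_sum fun k _ => Dvd.dvd.mul_right ?_ _
      rw [Matrix.mul_apply]
      exact Finset.dvd_sum fun l _ => Dvd.dvd.mul_left (hdvd _ _) _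
    refine ⟨Fin.cons a d, fun i => ?_, fun i j => ?_, ?_⟩
    · exact Fin.cases (fun _ => ha) (fun i => hmonic i) i
    · refine Fin.cases (fun _ => ?_) (fun i => ?_) i
      · exact Fin.cases dvd_rfl (fun j => had j) j
      · exact Fin.cases (fun h => absurd h (by simp)) (fun j h => hd i j (by simpa using h)) j
    · have h2 : Equivalent (bordered a N) (bordered a (diagonal d)) :=
        ⟨bordered 1 E, bordered 1 F, by simpa [det_bordered], by simpa [det_bordered],
          by simp [bordered_mul, hEF]⟩
      have h3 : bordered a (diagonal d) = diagonal (Fin.cons a d) := by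
        refine Matrix.ext fun i j => ?_
        refine Fin.cases ?_ (fun i => ?_) i <;> refine Fin.cases ?_ (fun j => ?_) j <;>
          simp [Matrix.diagonal_apply, Fin.succ_ne_zero, (Fin.succ_ne_zero _).symm]
      exact h3 ▸ h.trans h2

/-! ### Colengths of the cokernel of a polynomial matrix -/

/-- The submodule of the vectors `v` with `λ ^ j v` in the column module of `P`. -/
def colon {ι κ : Type*} [Fintype κ] (P : Matrix ι κ ℂ[X]) (j : ℕ) : Submodule ℂ[X] (ι → ℂ[X]) :=
  (LinearMap.range P.mulVecLin).comap (LinearMap.lsmul ℂ[X] (ι → ℂ[X]) (X ^ j))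

/-- The dimension of `λ ^ j N`, where `N` is the cokernel of `P`. -/
def colength {ι κ : Type*} [Fintype κ] (P : Matrix ι κ ℂ[X]) (j : ℕ) : ℕ :=
  Module.finrank ℂ ((ι → ℂ[X]) ⧸ colon P j)

theorem mem_colon {ι κ : Type*} [Fintype κ] {P : Matrix ι κ ℂ[X]} {j : ℕ} {v : ι → ℂ[X]} :
    v ∈ colon P j ↔ ∃ w, P *ᵥ w = (X ^ j : ℂ[X]) • v := Iff.rfl

theorem mem_colon_add {ι κ : Type*} [Fintype κ] {P : Matrix ι κ ℂ[X]} {i j : ℕ} {v : ι → ℂ[X]} :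
    v ∈ colon P (i + j) ↔ (X ^ j : ℂ[X]) • v ∈ colon P i := by
  simp only [mem_colon, smul_smul, pow_add]

/-- The first isomorphism theorem, with scalars restricted to ℂ so that dimensions can be compared.
-/
theorem nonempty_quotient_equiv {ι κ : Type*} {S : Submodule ℂ[X] (ι → ℂ[X])}
    {S' : Submodule ℂ[X] (κ → ℂ[X])} (π : (ι → ℂ[X]) →ₗ[ℂ[X]] (κ → ℂ[X]))
    (hπ : Function.Surjective π) (h : ∀ v, v ∈ S ↔ π v ∈ S') :
    Nonempty (((ι → ℂ[X]) ⧸ S) ≃ₗ[ℂ] ((κ → ℂ[X]) ⧸ S')) := by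
  have hk : LinearMap.ker (S'.mkQ ∘ₗ π) = S := by
    ext v
    simp [h v]
  exact ⟨((Submodule.quotEquivOfEq _ _ hk.symm).trans
    ((S'.mkQ ∘ₗ π).quotKerEquivOfSurjective
      ((Submodule.mkQ_surjective S').comp hπ))).restrictScalars ℂ⟩

/-- If `π` identifies `λ ^ i` times the cokernel of `P` with the cokernel of `P'`, it identifies
`λ ^ (j + i)` times the former with `λ ^ j` times the latter. -/
theorem nonempty_quotient_colon_equiv {ι κ ι' κ' : Type*} [Fintype ι'] [Fintype κ']
    {P : Matrix ι ι' ℂ[X]} {P' : Matrix κ κ' ℂ[X]} {i : ℕ} (π : (ι → ℂ[X]) →ₗ[ℂ[X]] (κ → ℂ[X]))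
    (hπ : Function.Surjective π) (h : ∀ v, v ∈ colon P i ↔ π v ∈ colon P' 0) (j : ℕ) :
    Nonempty (((ι → ℂ[X]) ⧸ colon P (i + j)) ≃ₗ[ℂ] ((κ → ℂ[X]) ⧸ colon P' j)) := by
  refine nonempty_quotient_equiv π hπ fun v => ?_
  conv_rhs => rw [← Nat.zero_add j]
  rw [mem_colon_add, mem_colon_add, h, map_smul]

theorem colength_eq_of_map {ι κ ι' κ' : Type*} [Fintype ι'] [Fintype κ']
    {P : Matrix ι ι' ℂ[X]} {P' : Matrix κ κ' ℂ[X]} {i : ℕ} (π : (ι → ℂ[X]) →ₗ[ℂ[X]] (κ → ℂ[X]))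
    (hπ : Function.Surjective π) (h : ∀ v, v ∈ colon P i ↔ π v ∈ colon P' 0) (j : ℕ) :
    colength P (i + j) = colength P' j :=
  (nonempty_quotient_colon_equiv π hπ h j).some.finrank_eq

theorem colon_zero_mul {n : ℕ} {P D E F : Matrix (Fin n) (Fin n) ℂ[X]} (hE : IsUnit E.det)
    (hF : IsUnit F.det) (h : E * P * F = D) (v : Fin n → ℂ[X]) :
    v ∈ colon P 0 ↔ E *ᵥ v ∈ colon D 0 := by
  subst h
  simp only [mem_colon, pow_zero, one_smul]
  constructor
  · rintro ⟨w, rfl⟩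
    exact ⟨F⁻¹ *ᵥ w, by simp [Matrix.mul_assoc, Matrix.mul_nonsing_inv _ hF]⟩
  · rintro ⟨w, hw⟩
    refine ⟨F *ᵥ w, ?_⟩
    have := congrArg (E⁻¹ *ᵥ ·) hw
    simpa [← Matrix.mul_assoc, Matrix.nonsing_inv_mul _ hE] using this

theorem mulVecLin_surjective {n : ℕ} {E : Matrix (Fin n) (Fin n) ℂ[X]} (hE : IsUnit E.det) :
    Function.Surjective E.mulVecLin :=
  Matrix.mulVec_surjective_iff_isUnit.mpr ((Matrix.isUnit_iff_isUnit_det E).mpr hE)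

/-- Dividing out of `d` the factor that it has in common with `λ ^ j`. -/
theorem exists_dvd_X_pow_mul_iff {d : ℂ[X]} (hd : d ≠ 0) (j : ℕ) :
    ∃ d' : ℂ[X], d' ≠ 0 ∧ d'.natDegree + min j (d.rootMultiplicity 0) = d.natDegree ∧
      ∀ f, d ∣ X ^ j * f ↔ d' ∣ f := by
  obtain ⟨e, he, hX⟩ := Polynomial.exists_eq_pow_rootMultiplicity_mul_and_not_dvd d hd 0
  rw [C_0, sub_zero] at he hX
  set μ := d.rootMultiplicity 0
  have he0 : e ≠ 0 := by rintro rfl; exact hX (dvd_zero _)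
  have hdeg : d.natDegree = μ + e.natDegree := by
    rw [he, Polynomial.natDegree_mul (pow_ne_zero _ X_ne_zero) he0, Polynomial.natDegree_X_pow]
  rcases le_total j μ with hj | hj
  · obtain ⟨k, hk⟩ := Nat.exists_eq_add_of_le hj
    refine ⟨X ^ k * e, mul_ne_zero (pow_ne_zero _ X_ne_zero) he0, ?_, fun f => ?_⟩
    · rw [Polynomial.natDegree_mul (pow_ne_zero _ X_ne_zero) he0, Polynomial.natDegree_X_pow, hdeg]
      omega
    · rw [he, hk, pow_add, mul_assoc]
      exact mul_dvd_mul_iff_left (pow_ne_zero _ X_ne_zero)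
  · obtain ⟨k, hk⟩ := Nat.exists_eq_add_of_le hj
    -- Here λ^j absorbs the whole λ-part of d; the remaining factor e is coprime to λ.
    refine ⟨e, he0, by omega, fun f => ?_⟩
    rw [he, hk, pow_add, mul_assoc, mul_dvd_mul_iff_left (pow_ne_zero _ X_ne_zero)]
    have hc : IsCoprime e (X ^ k) :=
      ((Polynomial.prime_X.irreducible.coprime_iff_not_dvd).mpr hX).symm.pow_right
    exact ⟨hc.dvd_of_dvd_mul_left, fun h => h.mul_left _⟩

/-- The cokernel splits as the sum of the ℂ[λ]/(d_i). Passing to λ^j times a summand replaces d_i by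
d_i / gcd(d_i, λ^j), which lowers the degree by min(j, μ_i). -/
theorem colength_diagonal {n : ℕ} {d : Fin n → ℂ[X]} (hd : ∀ i, d i ≠ 0) (j : ℕ) :
    Module.Finite ℂ ((Fin n → ℂ[X]) ⧸ colon (diagonal d) j) ∧
      colength (diagonal d) j + ∑ i, min j ((d i).rootMultiplicity 0) =
        ∑ i, (d i).natDegree := by
  choose d' hd' hdeg hdvd using fun i => exists_dvd_X_pow_mul_iff (hd i) j
  have hS : colon (diagonal d) j = Submodule.pi Set.univ fun i => Ideal.span {d' i} := by
    ext v
    simp only [mem_colon, Submodule.mem_pi, Set.mem_univ, true_imp_iff, Ideal.mem_span_singleton,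
      ← hdvd]
    constructor
    · rintro ⟨w, hw⟩ i
      exact ⟨w i, by simpa [Matrix.mulVec_diagonal] using (congrFun hw i).symm⟩
    · intro h
      choose w hw using h
      exact ⟨w, funext fun i => by simpa [Matrix.mulVec_diagonal] using (hw i).symm⟩
  have hfin : ∀ i, Module.Finite ℂ (ℂ[X] ⧸ Ideal.span {d' i}) := fun i =>
    (AdjoinRoot.powerBasis (hd' i)).finite
  let e : ((Fin n → ℂ[X]) ⧸ colon (diagonal d) j) ≃ₗ[ℂ] (∀ i, ℂ[X] ⧸ Ideal.span {d' i}) :=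
    ((Submodule.quotEquivOfEq _ _ hS).trans (Submodule.quotientPi _)).restrictScalars ℂ
  refine ⟨Module.Finite.equiv e.symm, ?_⟩
  have : colength (diagonal d) j = ∑ i, (d' i).natDegree := by
    rw [colength, e.finrank_eq, Module.finrank_pi_fintype]
    exact Finset.sum_congr rfl fun i _ => finrank_quotient_span_eq_natDegree
  rw [this, ← Finset.sum_add_distrib]
  exact Finset.sum_congr rfl fun i _ => hdeg i

/-! ### Pencils -/

/-- The pencil `A - λ B`. -/
def pencil {ι κ : Type*} (A B : Matrix ι κ ℂ) : Matrix ι κ ℂ[X] :=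
  A.map C - (X : ℂ[X]) • B.map C

theorem eval_zero_pencil_mulVec {ι κ : Type*} [Fintype κ] (A B : Matrix ι κ ℂ) (w : κ → ℂ[X])
    (i : ι) : ((pencil A B *ᵥ w) i).eval 0 = (A *ᵥ fun k => (w k).eval 0) i := by
  simp [pencil, Matrix.mulVec, dotProduct, Polynomial.eval_finsetSum]

theorem exists_eq_X_smul {ι : Type*} {w : ι → ℂ[X]} (h : ∀ i, (w i).eval 0 = 0) :
    ∃ u : ι → ℂ[X], w = (X : ℂ[X]) • u := by
  have : ∀ i, X ∣ w i := fun i => by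
    rw [Polynomial.X_dvd_iff, Polynomial.coeff_zero_eq_eval_zero, h]
  choose u hu using this
  exact ⟨u, funext hu⟩

theorem X_smul_injective {ι : Type*} : Function.Injective fun v : ι → ℂ[X] => (X : ℂ[X]) • v :=
  fun _ _ h => funext fun i => mul_left_cancel₀ X_ne_zero (congrFun h i)

/-- The rank of the constant coefficient measures the cokernel of `λ` on the cokernel of the
pencil. -/
theorem colength_pencil_one {m : ℕ} (A B : Matrix (Fin m) (Fin m) ℂ)
    [Module.Finite ℂ ((Fin m → ℂ[X]) ⧸ colon (pencil A B) 0)] :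
    Module.Finite ℂ ((Fin m → ℂ[X]) ⧸ colon (pencil A B) 1) ∧
      colength (pencil A B) 1 + m = colength (pencil A B) 0 + A.rank := by
  set P := pencil A B with hP
  let S₀ := (colon P 0).restrictScalars ℂ
  let S₁ := (colon P 1).restrictScalars ℂ
  let e₀ : ((Fin m → ℂ[X]) ⧸ S₀) ≃ₗ[ℂ] ((Fin m → ℂ[X]) ⧸ colon P 0) :=
    Submodule.Quotient.restrictScalarsEquiv ℂ (colon P 0)
  let e₁ : ((Fin m → ℂ[X]) ⧸ S₁) ≃ₗ[ℂ] ((Fin m → ℂ[X]) ⧸ colon P 1) :=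
    Submodule.Quotient.restrictScalarsEquiv ℂ (colon P 1)
  have : Module.Finite ℂ ((Fin m → ℂ[X]) ⧸ S₀) := Module.Finite.equiv e₀.symm
  let χ : (Fin m → ℂ[X]) →ₗ[ℂ] (Fin m → ℂ[X]) :=
    (LinearMap.lsmul ℂ[X] (Fin m → ℂ[X]) X).restrictScalars ℂ
  have hχ : ∀ v, χ v = (X : ℂ[X]) • v := fun v => rfl
  have hS : ∀ v, v ∈ S₁ ↔ χ v ∈ S₀ := fun v => by
    have := mem_colon_add (P := P) (i := 0) (j := 1) (v := v)
    rwa [pow_one] at this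
  -- With N the cokernel of P, the maps φ (multiplication by λ) and ψ (evaluation at λ = 0) form an
  -- exact sequence 0 → λN → N → coker A → 0; the dimension formula is read off from it.
  let φ : ((Fin m → ℂ[X]) ⧸ S₁) →ₗ[ℂ] ((Fin m → ℂ[X]) ⧸ S₀) :=
    S₁.mapQ S₀ χ fun v hv => (hS v).mp hv
  have hφ : Function.Injective φ := by
    rw [← LinearMap.ker_eq_bot]
    refine LinearMap.ker_eq_bot'.mpr fun x => ?_
    obtain ⟨v, rfl⟩ := Submodule.Quotient.mk_surjective _ x
    intro h
    rw [Submodule.mapQ_apply, Submodule.Quotient.mk_eq_zero] at h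
    exact (Submodule.Quotient.mk_eq_zero _).mpr ((hS v).mpr h)
  let Ψ : (Fin m → ℂ[X]) →ₗ[ℂ] (Fin m → ℂ) ⧸ LinearMap.range A.mulVecLin :=
    (LinearMap.range A.mulVecLin).mkQ ∘ₗ (Polynomial.leval (0 : ℂ)).compLeft (Fin m)
  have hΨ : ∀ v, Ψ v = 0 ↔ ∃ a, A *ᵥ a = fun i => (v i).eval 0 := fun v => by
    simp only [Ψ, LinearMap.comp_apply, Submodule.mkQ_apply, Submodule.Quotient.mk_eq_zero]
    rfl
  have hΨS : ∀ v ∈ S₀, Ψ v = 0 := by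
    rintro v ⟨w, hw⟩
    refine (hΨ v).mpr ⟨fun i => (w i).eval 0, funext fun i => ?_⟩
    rw [← eval_zero_pencil_mulVec A B]
    have := congrArg (Polynomial.eval 0) (congrFun hw i)
    simpa using this
  let ψ := S₀.liftQ Ψ hΨS
  have hψ : Function.Surjective ψ := by
    intro y
    obtain ⟨a, rfl⟩ := Submodule.Quotient.mk_surjective _ y
    refine ⟨S₀.mkQ fun i => C (a i), ?_⟩
    change Submodule.Quotient.mk _ = _
    congr 1
    ext i
    exact Polynomial.eval_C
  have hker : LinearMap.ker ψ = LinearMap.range φ := by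
    apply le_antisymm
    · intro x hx
      obtain ⟨v, rfl⟩ := Submodule.Quotient.mk_surjective _ x
      obtain ⟨a, ha⟩ := (hΨ v).mp hx
      -- If v(0) = Aa, then v - Pa vanishes at 0, hence equals λz, and v and λz have the same class
      -- in N.
      obtain ⟨z, hz⟩ := exists_eq_X_smul (w := v - P *ᵥ fun i => C (a i)) fun i => by
        have := eval_zero_pencil_mulVec A B (fun i => C (a i)) i
        simp only [Pi.sub_apply, Polynomial.eval_sub, hP, this, Polynomial.eval_C, ha, sub_self]
      refine ⟨S₁.mkQ z, (Submodule.Quotient.eq _).mpr ?_⟩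
      change (X : ℂ[X]) • z - v ∈ colon P 0
      rw [← hz, mem_colon]
      exact ⟨-fun i => C (a i), by rw [Matrix.mulVec_neg]; simp⟩
    · rintro _ ⟨x, rfl⟩
      obtain ⟨v, rfl⟩ := Submodule.Quotient.mk_surjective _ x
      refine (hΨ _).mpr ⟨0, ?_⟩
      ext i
      simp [hχ]
  have h1 := LinearMap.finrank_range_add_finrank_ker ψ
  rw [hker, LinearMap.finrank_range_of_inj hφ, LinearMap.range_eq_top.mpr hψ, finrank_top,
    e₀.finrank_eq, e₁.finrank_eq] at h1
  have h2 := Submodule.finrank_quotient_add_finrank (LinearMap.range A.mulVecLin)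
  rw [Module.finrank_fin_fun] at h2
  have : Module.Finite ℂ ((Fin m → ℂ[X]) ⧸ S₁) := Module.Finite.of_injective φ hφ
  refine ⟨Module.Finite.equiv e₁, ?_⟩
  change _ + _ = _ + Module.finrank ℂ (LinearMap.range A.mulVecLin)
  unfold colength
  omega

/-- If Pw = λv, then A w(0) = 0, so w = λu and v = Pu: multiplication by λ is injective on the
cokernel. -/
theorem colength_pencil_of_isUnit {m : ℕ} {A : Matrix (Fin m) (Fin m) ℂ} (hA : IsUnit A.det)
    (B : Matrix (Fin m) (Fin m) ℂ) (j : ℕ) :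
    colength (pencil A B) (1 + j) = colength (pencil A B) j := by
  refine colength_eq_of_map LinearMap.id Function.surjective_id (fun v => ?_) j
  simp only [mem_colon, pow_one, pow_zero, one_smul, LinearMap.id_apply]
  constructor
  · rintro ⟨w, hw⟩
    have h0 : (fun k => (w k).eval 0) = 0 := by
      refine Matrix.eq_zero_of_mulVec_eq_zero hA.ne_zero (funext fun i => ?_)
      rw [← eval_zero_pencil_mulVec A B, hw]
      simp
    obtain ⟨u, rfl⟩ := exists_eq_X_smul (congrFun h0)
    exact ⟨u, X_smul_injective (by simpa [Matrix.mulVec_smul] using hw)⟩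
  · rintro ⟨w, rfl⟩
    exact ⟨(X : ℂ[X]) • w, by rw [Matrix.mulVec_smul]⟩

/-! ### The deflation step -/

/-- The splitting of the indices into the first `r` and the last `s`. -/
def splitEquiv {m r s : ℕ} (h : r + s = m) : Fin r ⊕ Fin s ≃ Fin m :=
  finSumFinEquiv.trans (finCongr h)

theorem splitEquiv_inl {m r s : ℕ} (h : r + s = m) (i : Fin r) :
    splitEquiv h (Sum.inl i) = firstIdx h i := rfl

theorem splitEquiv_inr {m r s : ℕ} (h : r + s = m) (i : Fin s) :
    splitEquiv h (Sum.inr i) = lastIdx h i := rfl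

theorem exists_split {α : Type*} {m r s : ℕ} (h : r + s = m) (u : Fin r → α) (t : Fin s → α) :
    ∃ w : Fin m → α, w ∘ firstIdx h = u ∧ w ∘ lastIdx h = t := by
  refine ⟨Sum.elim u t ∘ (splitEquiv h).symm, ?_, ?_⟩ <;> funext i
  · simp [← splitEquiv_inl]
  · simp [← splitEquiv_inr]

theorem split_ext {α : Type*} {m r s : ℕ} (h : r + s = m) {v w : Fin m → α}
    (h₁ : v ∘ firstIdx h = w ∘ firstIdx h) (h₂ : v ∘ lastIdx h = w ∘ lastIdx h) : v = w := by
  funext i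
  obtain ⟨k, rfl⟩ := (splitEquiv h).surjective i
  cases k
  · exact congrFun h₁ _
  · exact congrFun h₂ _

theorem mulVec_comp_split {R ι : Type*} [CommRing R] {m r s : ℕ} (h : r + s = m)
    (M : Matrix (Fin m) (Fin m) R) (w : Fin m → R) (f : ι → Fin m) :
    (M *ᵥ w) ∘ f = M.submatrix f (firstIdx h) *ᵥ (w ∘ firstIdx h) +
      M.submatrix f (lastIdx h) *ᵥ (w ∘ lastIdx h) := by
  funext i
  simp only [Function.comp_apply, Matrix.mulVec, dotProduct, Pi.add_apply, Matrix.submatrix_apply]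
  rw [← (splitEquiv h).sum_comp, Fintype.sum_sum_type]
  rfl

theorem pencil_submatrix {ι κ ι' κ' : Type*} (A B : Matrix ι κ ℂ) (f : ι' → ι) (g : κ' → κ) :
    (pencil A B).submatrix f g = pencil (A.submatrix f g) (B.submatrix f g) := rfl

theorem pencil_zero_zero {ι κ : Type*} : pencil (0 : Matrix ι κ ℂ) 0 = 0 := by
  simp [pencil]

theorem pencil_zero_mulVec {ι κ : Type*} [Fintype κ] (B : Matrix ι κ ℂ) (t : κ → ℂ[X]) :
    pencil 0 B *ᵥ t = -((X : ℂ[X]) • (B.map C *ᵥ t)) := by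
  simp [pencil, Matrix.neg_mulVec, Matrix.smul_mulVec]

/-- The pencil that a deflation step passes on is regular, and its cokernel is `λ` times that of
the original pencil. Here the pencil is already in deflated form. -/
theorem deflated_pencil {m r s : ℕ} (h : r + s = m) (h' : s + r = m)
    {T W : Matrix (Fin m) (Fin m) ℂ}
    (hT : ∀ w, T *ᵥ w = 0 ↔ w ∘ firstIdx h = 0)
    (hW : W.submatrix (lastIdx h') (lastIdx h) = 0)
    (hinj : ∀ w, pencil T W *ᵥ w = 0 → w = 0) :
    (∀ u, pencil (T.submatrix (lastIdx h') (firstIdx h))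
        (W.submatrix (lastIdx h') (firstIdx h)) *ᵥ u = 0 → u = 0) ∧
      ∀ y : Fin m → ℂ[X], y ∈ colon (pencil T W) 1 ↔
        y ∘ lastIdx h' ∈ colon (pencil (T.submatrix (lastIdx h') (firstIdx h))
          (W.submatrix (lastIdx h') (firstIdx h))) 0 := by
  -- With rows split as s + r and columns as r + s, the pencil is [P₁, -λB₁; P', 0].
  set P' := pencil (T.submatrix (lastIdx h') (firstIdx h)) (W.submatrix (lastIdx h') (firstIdx h))
  set P₁ := pencil (T.submatrix (firstIdx h') (firstIdx h)) (W.submatrix (firstIdx h') (firstIdx h))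
  set B₁ := W.submatrix (firstIdx h') (lastIdx h)
  have hTl : ∀ i c, T i (lastIdx h c) = 0 := by
    intro i c
    have : T *ᵥ Pi.single (lastIdx h c) 1 = 0 := by
      refine (hT _).mpr (funext fun k => ?_)
      have : firstIdx h k ≠ lastIdx h c := by
        have := k.isLt
        simp only [ne_eq, firstIdx, lastIdx, Fin.mk.injEq]
        omega
      simp [this]
    simpa using congrFun this i
  have hT1 : T.submatrix (firstIdx h') (lastIdx h) = 0 := Matrix.ext fun i c => hTl _ c
  have hT2 : T.submatrix (lastIdx h') (lastIdx h) = 0 := Matrix.ext fun i c => hTl _ c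
  have hbot : ∀ w, (pencil T W *ᵥ w) ∘ lastIdx h' = P' *ᵥ (w ∘ firstIdx h) := by
    intro w
    rw [mulVec_comp_split h, pencil_submatrix, pencil_submatrix, hT2, hW, pencil_zero_zero,
      Matrix.zero_mulVec, add_zero]
  have htop : ∀ w, (pencil T W *ᵥ w) ∘ firstIdx h' =
      P₁ *ᵥ (w ∘ firstIdx h) - (X : ℂ[X]) • (B₁.map C *ᵥ (w ∘ lastIdx h)) := by
    intro w
    rw [mulVec_comp_split h, pencil_submatrix, pencil_submatrix, hT1, pencil_zero_mulVec,
      ← sub_eq_add_neg]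
  -- A kernel vector t of B₁ would make the constant vector (0, t) a kernel vector of the whole
  -- pencil.
  have hB : IsUnit B₁.det := by
    rw [isUnit_iff_ne_zero]
    intro hdet
    obtain ⟨t, ht0, ht⟩ := Matrix.exists_mulVec_eq_zero_iff.mpr hdet
    obtain ⟨w, hw1, hw2⟩ := exists_split h (0 : Fin r → ℂ[X]) (fun i => C (t i))
    have hBt : B₁.map C *ᵥ (fun i => C (t i)) = 0 := funext fun i => by
      have := RingHom.map_mulVec (C : ℂ →+* ℂ[X]) B₁ t i
      rw [ht] at this
      simpa [Function.comp_def] using this.symm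
    have hw : w = 0 := hinj w <| split_ext h'
      (by rw [htop, hw1, hw2, hBt]; simp) (by rw [hbot, hw1]; simp)
    refine ht0 (funext fun i => ?_)
    have := congrFun hw2 i
    simpa [hw] using this.symm
  have hsolve : ∀ z : Fin s → ℂ[X], ∃ t, B₁.map C *ᵥ t = z := fun z =>
    ⟨B₁⁻¹.map C *ᵥ z, by
      rw [Matrix.mulVec_mulVec, ← Matrix.map_mul, Matrix.mul_nonsing_inv _ hB]; simp⟩
  refine ⟨fun u hu => ?_, fun y => ?_⟩
  · obtain ⟨t, ht⟩ := hsolve (P₁ *ᵥ u)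
    -- If P'u = 0 and B₁t = P₁u, then (λu, t) is killed by the pencil.
    obtain ⟨w, hw1, hw2⟩ := exists_split h ((X : ℂ[X]) • u) t
    have hw : w = 0 := hinj w <| split_ext h'
      (by rw [htop, hw1, hw2, ht, Matrix.mulVec_smul, sub_self]; rfl)
      (by rw [hbot, hw1, Matrix.mulVec_smul, hu, smul_zero]; rfl)
    refine X_smul_injective (?_ : (X : ℂ[X]) • u = (X : ℂ[X]) • (0 : Fin r → ℂ[X]))
    rw [← hw1, hw, smul_zero]
    rfl
  · simp only [mem_colon, pow_one, pow_zero, one_smul]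
    constructor
    · rintro ⟨w, hw⟩
      -- At λ = 0 the equation reads T w(0) = 0, so the first r entries of w are divisible by λ; the
      -- lower rows can then be divided by λ.
      have h0 : (fun k => (w k).eval 0) ∘ firstIdx h = 0 := by
        refine (hT _).mp (funext fun i => ?_)
        rw [← eval_zero_pencil_mulVec T W, hw]
        simp
      obtain ⟨u, hu⟩ := exists_eq_X_smul (w := w ∘ firstIdx h) (congrFun h0)
      refine ⟨u, X_smul_injective ?_⟩
      change (X : ℂ[X]) • _ = (X : ℂ[X]) • _
      rw [← Matrix.mulVec_smul, ← hu, ← hbot, hw]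
      rfl
    · rintro ⟨u, hu⟩
      -- The invertible B₁ lets t absorb any prescribed upper part of y.
      obtain ⟨t, ht⟩ := hsolve (P₁ *ᵥ u - y ∘ firstIdx h')
      obtain ⟨w, hw1, hw2⟩ := exists_split h ((X : ℂ[X]) • u) t
      refine ⟨w, split_ext h' ?_ ?_⟩
      · rw [htop, hw1, hw2, ht, Matrix.mulVec_smul, smul_sub, sub_sub_cancel]
        rfl
      · rw [hbot, hw1, Matrix.mulVec_smul, hu]
        rfl

/-- In a singular value decomposition, exactly the first `rank` singular values are nonzero. -/
theorem IsSVD.singularValue_ne_zero_iff {m : ℕ} {Y U V : Matrix (Fin m) (Fin m) ℂ} {σ : ℕ → ℝ}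
    (hY : IsSVD Y U σ V) (i : Fin m) : σ i ≠ 0 ↔ (i : ℕ) < Y.rank := by
  have hdiag : (Matrix.of fun (i : Fin m) (j : Fin m) =>
      if (i : ℕ) = (j : ℕ) then (σ i : ℂ) else 0) = diagonal fun i : Fin m => (σ i : ℂ) := by
    ext i j
    simp [Matrix.diagonal_apply, Fin.ext_iff]
  have hU : IsUnit U.det := Matrix.UnitaryGroup.det_isUnit ⟨U, hY.unitary_left⟩
  have hV : IsUnit Vᴴ.det := Matrix.UnitaryGroup.det_isUnit ⟨Vᴴ, Unitary.star_mem hY.unitary_right⟩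
  -- The rank counts the nonzero σ_i. As σ is nonnegative and decreasing, these form an initial
  -- segment, so counting locates its end.
  have hrank : Y.rank = (Finset.univ.filter fun i : Fin m => σ i ≠ 0).card := by
    rw [hY.eq, hdiag, Matrix.rank_mul_eq_left_of_isUnit_det _ _ hV,
      Matrix.rank_mul_eq_right_of_isUnit_det _ _ hU, Matrix.rank_diagonal, Fintype.card_subtype]
    simp
  rw [hrank]
  constructor
  · intro hi
    have : Finset.Iic i ⊆ Finset.univ.filter fun i : Fin m => σ i ≠ 0 := fun k hk => by
      have h1 : σ i ≤ σ k := hY.antitone (by simpa using hk)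
      have h2 := (hY.nonneg i).lt_of_ne' hi
      simpa using (h2.trans_le h1).ne'
    have := Finset.card_le_card this
    rw [Fin.card_Iic] at this
    omega
  · intro hi h0
    have : (Finset.univ.filter fun i : Fin m => σ i ≠ 0) ⊆ Finset.Iio i := fun k hk => by
      by_contra hk'
      have h1 : σ k ≤ σ i := hY.antitone (by simpa using hk')
      have h2 : σ k ≠ 0 := by simpa using hk
      exact h2 (le_antisymm (h0 ▸ h1) (hY.nonneg k))
    have := Finset.card_le_card this
    rw [Fin.card_Iio] at this
    omega

theorem pencil_mul {m : ℕ} (U A B V : Matrix (Fin m) (Fin m) ℂ) :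
    U.map C * pencil A B * V.map C = pencil (U * A * V) (U * B * V) := by
  simp [pencil, Matrix.map_mul, Matrix.mul_sub, Matrix.sub_mul]

theorem isUnit_det_map_C {m : ℕ} {U : Matrix (Fin m) (Fin m) ℂ} (hU : IsUnit U.det) :
    IsUnit (U.map C).det := by
  have := hU.map (C : ℂ →+* ℂ[X])
  rwa [RingHom.map_det] at this

/-- A deflation step passes on a pencil whose cokernel is `λ` times that of the original one. -/
theorem DeflationStep.cokernel {m r s : ℕ} {h : r + s = m} {A B : Matrix (Fin m) (Fin m) ℂ}
    {A' B' : Matrix (Fin r) (Fin r) ℂ} (hstep : DeflationStep h A B A' B')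
    (hinj : ∀ w, pencil A B *ᵥ w = 0 → w = 0) :
    (∀ u, pencil A' B' *ᵥ u = 0 → u = 0) ∧
      ∃ π : (Fin m → ℂ[X]) →ₗ[ℂ[X]] (Fin r → ℂ[X]), Function.Surjective π ∧
        ∀ v, v ∈ colon (pencil A B) 1 ↔ π v ∈ colon (pencil A' B') 0 := by
  obtain ⟨hr, UA, VA, σ, UB, VB, τ, hA, hB, rfl, rfl⟩ := hstep
  have h' : s + r = m := (Nat.add_comm s r).trans h
  have hUA : IsUnit UA.det := Matrix.UnitaryGroup.det_isUnit ⟨UA, hA.unitary_left⟩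
  have hVA : IsUnit VA.det := Matrix.UnitaryGroup.det_isUnit ⟨VA, hA.unitary_right⟩
  have hUB : IsUnit UBᴴ.det :=
    Matrix.UnitaryGroup.det_isUnit ⟨UBᴴ, Unitary.star_mem hB.unitary_left⟩
  have hVV : VAᴴ * VA = 1 := Matrix.mem_unitaryGroup_iff'.mp hA.unitary_right
  have hUU : UBᴴ * UB = 1 := Matrix.mem_unitaryGroup_iff'.mp hB.unitary_left
  have hT : ∀ w, (UBᴴ * A * VA) *ᵥ w = 0 ↔ w ∘ firstIdx h = 0 := by
    intro w
    -- The matrix is an invertible factor times Σ_A, and exactly the first r diagonal entries of Σ_A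
    -- are nonzero.
    have h1 : UBᴴ * A * VA = (UBᴴ * UA) * diagonal fun i : Fin m => (σ i : ℂ) := by
      have : (diagonal fun i : Fin m => (σ i : ℂ)) = Matrix.of fun (i : Fin m) (j : Fin m) =>
          if (i : ℕ) = (j : ℕ) then (σ i : ℂ) else 0 := by
        ext i j
        simp [Matrix.diagonal_apply, Fin.ext_iff]
      rw [this]
      conv_lhs => rw [hA.eq]
      simp only [Matrix.mul_assoc, hVV, Matrix.mul_one]
    have hdet : (UBᴴ * UA).det ≠ 0 := by
      rw [Matrix.det_mul]; exact (hUB.mul hUA).ne_zero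
    rw [h1, ← Matrix.mulVec_mulVec]
    have h2 : ∀ z, (UBᴴ * UA) *ᵥ z = 0 ↔ z = 0 := fun z =>
      ⟨Matrix.eq_zero_of_mulVec_eq_zero hdet, by rintro rfl; simp⟩
    rw [h2]
    simp only [funext_iff, Matrix.mulVec_diagonal, Pi.zero_apply, mul_eq_zero, Function.comp_apply,
      Complex.ofReal_eq_zero]
    constructor
    · intro hw i
      refine (hw (firstIdx h i)).resolve_left ((hA.singularValue_ne_zero_iff _).mpr ?_)
      rw [hr]
      exact i.isLt
    · intro hw i
      by_cases hi : (i : ℕ) < r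
      · exact Or.inr (hw ⟨i, hi⟩)
      · left
        by_contra h0
        exact hi (hr ▸ (hA.singularValue_ne_zero_iff i).mp h0)
  have hW : (UBᴴ * B * VA).submatrix (lastIdx h') (lastIdx h) = 0 := by
    -- Multiplying by U_B* turns the last s columns of B V_A into Σ_B V_B*, whose rows from index s
    -- on vanish.
    have h1 : (UBᴴ * B * VA).submatrix id (lastIdx h) =
        (Matrix.of fun (i : Fin m) (j : Fin s) =>
          if (i : ℕ) = (j : ℕ) then (τ i : ℂ) else 0) * VBᴴ := by
      have : (UBᴴ * B * VA).submatrix id (lastIdx h) =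
          UBᴴ * (B * VA).submatrix id (lastIdx h) := by
        rw [Matrix.mul_assoc]; rfl
      rw [this, hB.eq, Matrix.mul_assoc, ← Matrix.mul_assoc, hUU, Matrix.one_mul]
    ext i c
    have h2 := congrFun (congrFun h1 (lastIdx h' i)) c
    rw [Matrix.submatrix_apply, id] at h2
    rw [Matrix.submatrix_apply, h2, Matrix.mul_apply]
    refine Finset.sum_eq_zero fun k _ => ?_
    have : ¬ ((lastIdx h' i : Fin m) : ℕ) = k := by
      have := k.isLt
      simp only [lastIdx]
      omega
    simp [this]
  have hP := pencil_mul UBᴴ A B VA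
  have hUC := isUnit_det_map_C hUB
  have hVC := isUnit_det_map_C hVA
  have hinj' : ∀ w, pencil (UBᴴ * A * VA) (UBᴴ * B * VA) *ᵥ w = 0 → w = 0 := by
    intro w hw
    rw [← hP, ← Matrix.mulVec_mulVec, ← Matrix.mulVec_mulVec] at hw
    exact Matrix.eq_zero_of_mulVec_eq_zero hVC.ne_zero
      (hinj _ (Matrix.eq_zero_of_mulVec_eq_zero hUC.ne_zero hw))
  obtain ⟨h1, h2⟩ := deflated_pencil h h' hT hW hinj'
  refine ⟨h1, LinearMap.funLeft ℂ[X] ℂ[X] (lastIdx h') ∘ₗ (UBᴴ.map C).mulVecLin, ?_, fun v => ?_⟩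
  · intro z
    obtain ⟨y, -, hy⟩ := exists_split h' 0 z
    obtain ⟨w, rfl⟩ := mulVecLin_surjective hUC y
    exact ⟨w, hy⟩
  · have h3 : v ∈ colon (pencil A B) 1 ↔
        UBᴴ.map C *ᵥ v ∈ colon (pencil (UBᴴ * A * VA) (UBᴴ * B * VA)) 1 := by
      have := mem_colon_add (P := pencil A B) (i := 0) (j := 1) (v := v)
      have h4 := mem_colon_add (P := pencil (UBᴴ * A * VA) (UBᴴ * B * VA)) (i := 0) (j := 1)
        (v := UBᴴ.map C *ᵥ v)
      rw [Nat.zero_add] at this h4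
      rw [this, h4, colon_zero_mul hUC hVC hP, Matrix.mulVec_smul]
    exact h3.trans (h2 _)

/-- The indices of a run are the successive differences of the colengths. -/
theorem StaircaseRun.stairIndex_add_colength {m : ℕ} {A B : Matrix (Fin m) (Fin m) ℂ}
    {l : List ℕ} (hl : StaircaseRun A B l) (hinj : ∀ w, pencil A B *ᵥ w = 0 → w = 0)
    (hfin : Module.Finite ℂ ((Fin m → ℂ[X]) ⧸ colon (pencil A B) 0)) (j : ℕ) :
    stairIndex l (j + 1) + colength (pencil A B) (j + 1) = colength (pencil A B) j := by
  induction hl generalizing j with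
  | done A B hA =>
    rw [Nat.add_comm j 1, colength_pencil_of_isUnit hA]
    simp [stairIndex]
  | @step m r s h hs A B A' B' l hstep hrun ih =>
    obtain ⟨hinj', π, hπ, hv⟩ := hstep.cokernel hinj
    obtain ⟨hfin1, hdim⟩ := colength_pencil_one A B
    have hfin' : Module.Finite ℂ ((Fin r → ℂ[X]) ⧸ colon (pencil A' B') 0) :=
      Module.Finite.equiv (nonempty_quotient_colon_equiv π hπ hv 0).some
    -- The new pencil's colengths are the old ones shifted by one, just as its indices are; only the
    -- first index needs the rank formula.
    have hco : ∀ j, colength (pencil A B) (j + 1) = colength (pencil A' B') j := fun j => by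
      rw [Nat.add_comm]; exact colength_eq_of_map π hπ hv j
    cases j with
    | zero =>
      have := hstep.1
      simp only [stairIndex, Nat.zero_add, Nat.sub_self, List.getD_cons_zero]
      omega
    | succ j =>
      rw [hco, hco, ← ih hinj' hfin' j]
      simp [stairIndex]

/-! ### The companion pencil -/

/-- The upper half of the companion pencil applied to a vector. -/
theorem pencil_companion_mulVec_first {n : ℕ} (M C₁ K : Matrix (Fin n) (Fin n) ℂ)
    (w : Fin (n + n) → ℂ[X]) :
    (pencil (companionA C₁ K) (companionB M) *ᵥ w) ∘ firstIdx rfl =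
      C₁.map C *ᵥ (w ∘ firstIdx rfl) + (X : ℂ[X]) • (M.map C *ᵥ (w ∘ firstIdx rfl)) -
        w ∘ lastIdx rfl := by
  have hf : ∀ i : Fin n, finSumFinEquiv.symm (firstIdx rfl i : Fin (n + n)) = Sum.inl i :=
    fun i => (Equiv.symm_apply_eq _).mpr rfl
  have hl : ∀ i : Fin n, finSumFinEquiv.symm (lastIdx rfl i : Fin (n + n)) = Sum.inr i :=
    fun i => (Equiv.symm_apply_eq _).mpr rfl
  have h1 : (pencil (companionA C₁ K) (companionB M)).submatrix (firstIdx rfl) (firstIdx rfl) =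
      C₁.map C + (X : ℂ[X]) • M.map C := by
    refine Matrix.ext fun i j => ?_
    simp [pencil, companionA, companionB, hf]
  have h2 : (pencil (companionA C₁ K) (companionB M)).submatrix (firstIdx rfl) (lastIdx rfl) =
      -1 := by
    refine Matrix.ext fun i j => ?_
    simp [pencil, companionA, companionB, hf, hl, Matrix.one_apply, apply_ite C]
  rw [mulVec_comp_split rfl, h1, h2, Matrix.add_mulVec, Matrix.smul_mulVec, Matrix.neg_mulVec,
    Matrix.one_mulVec, sub_eq_add_neg]

/-- The lower half of the companion pencil applied to a vector. -/
theorem pencil_companion_mulVec_last {n : ℕ} (M C₁ K : Matrix (Fin n) (Fin n) ℂ)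
    (w : Fin (n + n) → ℂ[X]) :
    (pencil (companionA C₁ K) (companionB M) *ᵥ w) ∘ lastIdx rfl =
      K.map C *ᵥ (w ∘ firstIdx rfl) + (X : ℂ[X]) • (w ∘ lastIdx rfl) := by
  have hf : ∀ i : Fin n, finSumFinEquiv.symm (firstIdx rfl i : Fin (n + n)) = Sum.inl i :=
    fun i => (Equiv.symm_apply_eq _).mpr rfl
  have hl : ∀ i : Fin n, finSumFinEquiv.symm (lastIdx rfl i : Fin (n + n)) = Sum.inr i :=
    fun i => (Equiv.symm_apply_eq _).mpr rfl
  have h1 : (pencil (companionA C₁ K) (companionB M)).submatrix (lastIdx rfl) (firstIdx rfl) =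
      K.map C := by
    refine Matrix.ext fun i j => ?_
    simp [pencil, companionA, companionB, hf, hl]
  have h2 : (pencil (companionA C₁ K) (companionB M)).submatrix (lastIdx rfl) (lastIdx rfl) =
      (X : ℂ[X]) • 1 := by
    refine Matrix.ext fun i j => ?_
    simp [pencil, companionA, companionB, hl, Matrix.one_apply, apply_ite C]
  rw [mulVec_comp_split rfl, h1, h2, Matrix.smul_mulVec, Matrix.one_mulVec]

theorem quadPoly_mulVec {n : ℕ} (M C₁ K : Matrix (Fin n) (Fin n) ℂ) (x : Fin n → ℂ[X]) :
    quadPoly M C₁ K *ᵥ x = K.map C *ᵥ x +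
      (X : ℂ[X]) • (C₁.map C *ᵥ x + (X : ℂ[X]) • (M.map C *ᵥ x)) := by
  simp only [quadPoly, Matrix.add_mulVec, Matrix.smul_mulVec, smul_add, smul_smul, pow_two]
  abel

theorem pencil_companion_injective {n : ℕ} {M C₁ K : Matrix (Fin n) (Fin n) ℂ}
    (hreg : (quadPoly M C₁ K).det ≠ 0) (w : Fin (n + n) → ℂ[X])
    (hw : pencil (companionA C₁ K) (companionB M) *ᵥ w = 0) : w = 0 := by
  have h1 := pencil_companion_mulVec_first M C₁ K w
  have h2 := pencil_companion_mulVec_last M C₁ K w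
  rw [hw] at h1 h2
  -- The upper half gives w₂ = (C₁ + λM) w₁; substituting this in the lower half gives Q w₁ = 0.
  have h3 := sub_eq_zero.mp h1.symm
  rw [← h3, ← quadPoly_mulVec] at h2
  have h4 := Matrix.eq_zero_of_mulVec_eq_zero hreg h2.symm
  refine split_ext rfl h4 ?_
  rw [← h3, h4]
  simp only [Matrix.mulVec_zero, smul_zero, add_zero]
  rfl

/-- The cokernel of the companion pencil is that of the quadratic polynomial. -/
theorem exists_companion_map {n : ℕ} (M C₁ K : Matrix (Fin n) (Fin n) ℂ) :
    ∃ π : (Fin (n + n) → ℂ[X]) →ₗ[ℂ[X]] (Fin n → ℂ[X]), Function.Surjective π ∧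
      ∀ v, v ∈ colon (pencil (companionA C₁ K) (companionB M)) 0 ↔
        π v ∈ colon (quadPoly M C₁ K) 0 := by
  -- The map (v₁, v₂) ↦ v₂ + λv₁ cancels the two λw₂ terms in the pencil applied to w, leaving Q w₁.
  refine ⟨LinearMap.funLeft ℂ[X] ℂ[X] (lastIdx rfl) +
    (X : ℂ[X]) • LinearMap.funLeft ℂ[X] ℂ[X] (firstIdx rfl), fun z => ?_, fun v => ?_⟩
  · obtain ⟨v, h1, h2⟩ := exists_split rfl (0 : Fin n → ℂ[X]) z
    refine ⟨v, ?_⟩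
    change v ∘ lastIdx rfl + (X : ℂ[X]) • (v ∘ firstIdx rfl) = z
    rw [h1, h2, smul_zero, add_zero]
  · simp only [mem_colon, pow_zero, one_smul]
    change _ ↔ ∃ w, _ = v ∘ lastIdx rfl + (X : ℂ[X]) • (v ∘ firstIdx rfl)
    constructor
    · rintro ⟨w, rfl⟩
      refine ⟨w ∘ firstIdx rfl, ?_⟩
      rw [quadPoly_mulVec, pencil_companion_mulVec_first, pencil_companion_mulVec_last]
      simp only [smul_sub, smul_add]
      abel
    · rintro ⟨x, hx⟩
      -- The second half of w is the one forced by the upper block equation.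
      obtain ⟨w, h1, h2⟩ := exists_split rfl x
        (C₁.map C *ᵥ x + (X : ℂ[X]) • (M.map C *ᵥ x) - v ∘ firstIdx rfl)
      refine ⟨w, split_ext rfl ?_ ?_⟩
      · rw [pencil_companion_mulVec_first, h1, h2, sub_sub_cancel]
      · rw [pencil_companion_mulVec_last, h1, h2, smul_sub, ← add_sub_assoc, ← quadPoly_mulVec,
          hx, add_sub_cancel_right]

/-! ### Counting elementary divisors by second differences -/

/-- The colengths of a regular polynomial matrix, in terms of its invariant polynomials. -/
theorem IsSmithForm.colength_add_sum {n : ℕ} {P : Matrix (Fin n) (Fin n) ℂ[X]} {d : Fin n → ℂ[X]}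
    (hd : IsSmithForm P d) (hP : P.det ≠ 0) (j : ℕ) :
    Module.Finite ℂ ((Fin n → ℂ[X]) ⧸ colon P j) ∧
      colength P j + ∑ i, min j ((d i).rootMultiplicity 0) = ∑ i, (d i).natDegree := by
  obtain ⟨E, F, hE, hF, hEF⟩ := hd.equiv
  have hd0 : ∀ i, d i ≠ 0 := by
    have : (diagonal d).det ≠ 0 := by
      rw [← hEF, Matrix.det_mul, Matrix.det_mul]
      exact mul_ne_zero (mul_ne_zero hE.ne_zero hP) hF.ne_zero
    rw [Matrix.det_diagonal] at this
    exact fun i => Finset.prod_ne_zero_iff.mp this i (Finset.mem_univ i)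
  obtain ⟨hfin, hdim⟩ := colength_diagonal hd0 j
  obtain ⟨e⟩ := nonempty_quotient_colon_equiv E.mulVecLin (mulVecLin_surjective hE)
    (colon_zero_mul hE hF hEF) j
  have he := e.finrank_eq
  rw [Nat.zero_add] at e he
  exact ⟨Module.Finite.equiv e.symm, by rw [colength, he]; exact hdim⟩

/-- As a function of j, min(j, μ) has its only bend at j = μ, where its second difference is -1. The
identity is arranged without subtraction in ℕ. -/
theorem zeroDivisorCount_succ {n : ℕ} (d : Fin n → ℂ[X]) (j : ℕ) :
    zeroDivisorCount d (j + 1) + (∑ i, min j ((d i).rootMultiplicity 0) +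
      ∑ i, min (j + 1 + 1) ((d i).rootMultiplicity 0)) =
        2 * ∑ i, min (j + 1) ((d i).rootMultiplicity 0) := by
  rw [zeroDivisorCount, Finset.card_filter, ← Finset.sum_add_distrib, ← Finset.sum_add_distrib,
    Finset.mul_sum]
  refine Finset.sum_congr rfl fun i _ => ?_
  split_ifs <;> omega

end QuadEig
end

/-- For a regular quadratic matrix polynomial `Q(λ) = λ² M + λ C + K`, the staircase algorithm
applied to the second companion form `C₂(λ)` can be carried out to its end, and the indices
`s₁, …, s_ℓ` of every run determine the structure of the eigenvalue zero of `Q`: the polynomial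
`Q` has exactly `s_j - s_{j+1}` elementary divisors `λ ^ j`, for every `j ≥ 1` (where `s_j = 0`
for `j > ℓ`). -/
theorem theoremt {n : ℕ} (M C K : Matrix (Fin n) (Fin n) ℂ)
    (hreg : (QuadEig.quadPoly M C K).det ≠ 0) :
    (∃ l : List ℕ, QuadEig.StaircaseRun (QuadEig.companionA C K) (QuadEig.companionB M) l) ∧
    (∃ d : Fin n → Polynomial ℂ, QuadEig.IsSmithForm (QuadEig.quadPoly M C K) d) ∧
    ∀ l : List ℕ, QuadEig.StaircaseRun (QuadEig.companionA C K) (QuadEig.companionB M) l →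
      ∀ d : Fin n → Polynomial ℂ, QuadEig.IsSmithForm (QuadEig.quadPoly M C K) d →
        ∀ j : ℕ, 1 ≤ j →
          (QuadEig.zeroDivisorCount d j : ℤ) =
            (QuadEig.stairIndex l j : ℤ) - (QuadEig.stairIndex l (j + 1) : ℤ) := by
  refine ⟨QuadEig.exists_staircaseRun _ _, QuadEig.exists_isSmithForm _, fun l hl d hd j hj => ?_⟩
  obtain ⟨k, rfl⟩ := Nat.exists_eq_add_of_le' hj
  obtain ⟨π, hπ, hv⟩ := QuadEig.exists_companion_map M C K
  have hfinQ := (hd.colength_add_sum hreg 0).1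
  have hfin := Module.Finite.equiv (QuadEig.nonempty_quotient_colon_equiv π hπ hv 0).some.symm
  have hco : ∀ j, QuadEig.colength
      (QuadEig.pencil (QuadEig.companionA C K) (QuadEig.companionB M)) j =
        QuadEig.colength (QuadEig.quadPoly M C K) j := fun j => by
    conv_lhs => rw [← Nat.zero_add j]
    exact QuadEig.colength_eq_of_map π hπ hv j
  have hs := hl.stairIndex_add_colength (QuadEig.pencil_companion_injective hreg) hfin
  have h1 := hs k
  have h2 := hs (k + 1)
  rw [hco, hco] at h1 h2
  have hc := QuadEig.zeroDivisorCount_succ d k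
  have d0 := (hd.colength_add_sum hreg k).2
  have d1 := (hd.colength_add_sum hreg (k + 1)).2
  have d2 := (hd.colength_add_sum hreg (k + 1 + 1)).2
  -- With j = k + 1 and c_i the colengths, s_j - s_(j+1) = c_k - 2c_(k+1) + c_(k+2); the constant ∑
  -- deg d_i cancels, leaving the count in `hc`.
  omega
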